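/- Let $n\ge 3$ and $m\ge 4$ be integers. Let $C_n$ be the undirected cycle on $n$ nodes and $S_m$ the undirected star on $m$ nodes (a hub joined to $m-1$ leaves), all edges having weight $1$ in both directions. For $\delta_0\ge 0$ let $G(\delta_0)$ be the weighted digraph obtained from the disjoint union of $C_n$ and $S_m$ by adding one directed edge of weight $1$ from a node $v$ of the cycle to the hub of the star, and one directed edge of weight $\delta_0$ from the hub back to the same node $v$. Let $L(\delta_0)=D-A$ be its Laplacian, where $A_{ij}$ is the weight of the edge from node $j$ to node $i$ and $D$ is the diagonal matrix with entries $D_{ii}=\sum_j A_{ij}$; so $L_G=L(0)$ is the Laplacian of the unmodified graph. The spectral gap $\lambda_2(L)$ is the second eigenvalue of $L$ when the eigenvalues are counted with algebraic multiplicity and ordered by increasing real part. For $0\le l\le n$ put $\alpha_l=2\left(1-\cos\frac{l\pi}{n}\right)$, and let $$\beta^-_{m,1}=\tfrac12\left[m+1-\sqrt{(m+1)^2-4}\right]$$ be the smaller root of $\lambda^2-(m+1)\lambda+1$. Assume $\beta^-_{m,1}\notin\{\alpha_l: 0\le l\le n\}$, and let $\delta_0>0$ be arbitrary. Then all eigenvalues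 of $L(\delta_0)$ (as well as those of $L(0)$) are real, and (i) if $\alpha_1<\beta^-_{m,1}$, then $\lambda_2(L(\delta_0))<\lambda_2(L(0))$; (ii) if $\beta^-_{m,1}<\alpha_1$, then $\lambda_2(L(\delta_0))>\lambda_2(L(0))$. -/

import Mathlib

/-! ### Weighted digraphs and the spectral gap -/

/-- The Laplacian `D - A` of the weighted digraph with adjacency matrix `A`, where `A i j` is the
weight of the directed edge from node `j` to node `i`, and `D` is the diagonal matrix of the
in-degrees `∑ j, A i j`. -/
def digraphLaplacian {V : Type*} [Fintype V] [DecidableEq V] (A : Matrix V V ℝ) :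
    Matrix V V ℝ :=
  Matrix.diagonal (fun i => ∑ j, A i j) - A

/-- The multiset of complex eigenvalues of a real square matrix, counted with algebraic
multiplicity. -/
noncomputable def complexEigenvalues {V : Type*} [Fintype V] [DecidableEq V]
    (L : Matrix V V ℝ) : Multiset ℂ :=
  (L.map (algebraMap ℝ ℂ)).charpoly.roots

/-- All complex eigenvalues of the real square matrix `L` are real. -/
def HasRealSpectrum {V : Type*} [Fintype V] [DecidableEq V] (L : Matrix V V ℝ) : Prop :=
  ∀ z ∈ complexEigenvalues L, z.im = 0

/-- The real parts of the eigenvalues `λ₁, λ₂, …` of `L`, with algebraic multiplicity, in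
increasing order. -/
noncomputable def sortedRealParts {V : Type*} [Fintype V] [DecidableEq V]
    (L : Matrix V V ℝ) : List ℝ :=
  ((complexEigenvalues L).map Complex.re).sort (· ≤ ·)

/-- The (real part of the) second smallest eigenvalue `λ₂` of `L`, eigenvalues being counted with
algebraic multiplicity and ordered by their real parts. It is `λ₂` itself if `L` has real spectrum.
(The default value `0` is only used for matrices of size less than two.) -/
noncomputable def spectralGap {V : Type*} [Fintype V] [DecidableEq V]
    (L : Matrix V V ℝ) : ℝ :=
  (sortedRealParts L).getD 1 0

/-! ### A cycle feeding the hub of a star, with a modification edge from the hub to the cycle -/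

/-- Adjacency matrix of the digraph on `Fin n ⊕ Fin m` that consists of the undirected cycle on
`Fin n`, the undirected star on `Fin m` with hub `0`, the cutset edge of weight `1` from node `0`
of the cycle to the hub of the star, and the modification edge of weight `δ₀` from the hub of the
star to node `0` of the cycle. All cycle and star edges have weight `1` in both directions.
Rows are end points and columns are starting points of edges. -/
noncomputable def cycleStarAdj (n m : ℕ) [NeZero n] [NeZero m] (δ₀ : ℝ) :
    Matrix (Fin n ⊕ Fin m) (Fin n ⊕ Fin m) ℝ :=
  open Classical in
  Matrix.fromBlocks
    ((SimpleGraph.cycleGraph n).adjMatrix ℝ) (Matrix.single 0 0 δ₀)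
    (Matrix.single 0 0 1) ((SimpleGraph.starGraph (0 : Fin m)).adjMatrix ℝ)

/-- The Laplacian of the graph modified by an edge of weight `δ₀`; the value `δ₀ = 0` gives the
unmodified graph. -/
noncomputable def cycleStarLaplacian (n m : ℕ) [NeZero n] [NeZero m] (δ₀ : ℝ) :
    Matrix (Fin n ⊕ Fin m) (Fin n ⊕ Fin m) ℝ :=
  digraphLaplacian (cycleStarAdj n m δ₀)

/-! ### The critical numbers -/

/-- `α_l = 2 (1 - cos (l π / n))`. -/
noncomputable def cycleAlpha (n l : ℕ) : ℝ :=
  2 * (1 - Real.cos ((l : ℝ) * Real.pi / (n : ℝ)))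

/-- The smaller root `β⁻_{m,w}` of `λ² - (m + w) λ + w`. -/
noncomputable def starBetaMinus (m : ℕ) (w : ℝ) : ℝ :=
  (((m : ℝ) + w) - Real.sqrt (((m : ℝ) + w) ^ 2 - 4 * w)) / 2

/-!
Rescaling the star by `s = √δ₀` turns the Laplacian `L(s²)` into the symmetric matrix
`M(s) = L_C ⊕ L_S + u uᵀ` with `u = s e_v - e_h`, where `L_C`, `L_S` are the Laplacians of the cycle
and of the star, `v` is the coupled node of the cycle and `h` the hub. For `s = 0`, where no
rescaling is possible, `L(0)` and `M(0)` are block triangular with the same diagonal blocks. So both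
have the same characteristic polynomial for all `s`
(`charpoly_cycleStarLaplacian`), and the spectrum is real. Moreover `M(s)` is positive semidefinite
and its kernel is spanned by `(1, s)`, so `λ₂` is its least positive eigenvalue.

Write a positive eigenvalue as `λ = 2 - 2 cos θ` and put `φ = n θ / 2`. If `sin θ` and `sin φ` do not
vanish, the eigenvector is on the cycle a wave symmetric about the node opposite to `v`; solving the
star for its value at the hub reduces the eigenvalue equation at `v` to
`2 sin φ sin θ (λ² - (m + 1) λ + 1) + δ₀ cos φ λ (m - λ) = 0`
(`eigenvector_equations`, `exists_eigenvector_of_characteristic_eq`). All bounds are read off from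
the signs of the two terms, where `φ = π / 2` corresponds to `λ = α₁` and `φ = π` to `λ = α₂`.

* For `δ₀ = 0` there is no solution with `0 < λ < min β⁻ α₂`, hence `min β⁻ α₂ ≤ λ₂(L(0))`, and
  `β⁻` is an eigenvalue of `L(0)`, hence `λ₂(L(0)) ≤ β⁻`.
* If `β⁻ < α₁`, then `cos φ > 0` for `0 < λ ≤ β⁻`, so there is no solution in this range when
  `δ₀ > 0`: the gap increases.
* If `α₁ < β⁻`, the left side is positive at `λ = α₁` and negative at `λ = min β⁻ α₂`, so there is
  a solution in between: the gap decreases.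
-/

/-! ### The spectral gap of a matrix with the spectrum of a symmetric matrix -/

theorem Multiset.sort_getD_one_le {s : Multiset ℝ} {a b : ℝ} (h : ({a, b} : Multiset ℝ) ≤ s) :
    (s.sort (· ≤ ·)).getD 1 0 ≤ max a b := by
  have hs : ((s.sort (· ≤ ·) : List ℝ) : Multiset ℝ) = s := Multiset.sort_eq s (· ≤ ·)
  have hp : (s.sort (· ≤ ·)).Pairwise (· ≤ ·) := Multiset.pairwise_sort s (· ≤ ·)
  have hlen : 2 ≤ (s.sort (· ≤ ·)).length := by
    rw [Multiset.length_sort]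
    simpa using Multiset.card_le_card h
  rw [← hs] at h
  generalize s.sort (· ≤ ·) = l at *
  match l, hlen with
  | x :: y :: t, _ =>
    simp only [List.pairwise_cons] at hp
    by_contra hlt
    simp only [List.getD_cons_succ, List.getD_cons_zero, not_le, max_lt_iff] at hlt
    have key : ∀ c ∈ ((x :: y :: t : List ℝ) : Multiset ℝ), c < y → c = x := by
      intro c hc hcy
      simp only [Multiset.mem_coe, List.mem_cons] at hc
      rcases hc with hc | hc | hc
      · exact hc
      · exact absurd hcy (by simp [hc])
      · exact absurd hcy (not_lt.mpr (hp.2.1 c hc))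
    have ha : a = x := key a (Multiset.mem_of_le h (by simp)) hlt.1
    have hb : b = x := key b (Multiset.mem_of_le h (by simp)) hlt.2
    subst ha
    rw [hb, ← Multiset.cons_coe, Multiset.insert_eq_cons, Multiset.cons_le_cons_iff,
      Multiset.singleton_le] at h
    simp only [Multiset.mem_coe, List.mem_cons] at h
    rcases h with h | h
    · linarith
    · linarith [hp.2.1 a h]

/-- The two smallest elements, as a sub-multiset; their multiplicity is accounted for. -/
theorem Multiset.exists_pair_le_sort_getD_one {s : Multiset ℝ} (hs : 2 ≤ s.card) :
    ∃ a b, ({a, b} : Multiset ℝ) ≤ s ∧ a ≤ (s.sort (· ≤ ·)).getD 1 0 ∧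
      b ≤ (s.sort (· ≤ ·)).getD 1 0 := by
  have hs' : ((s.sort (· ≤ ·) : List ℝ) : Multiset ℝ) = s := Multiset.sort_eq s (· ≤ ·)
  have hp : (s.sort (· ≤ ·)).Pairwise (· ≤ ·) := Multiset.pairwise_sort s (· ≤ ·)
  have hlen : 2 ≤ (s.sort (· ≤ ·)).length := by rwa [Multiset.length_sort]
  generalize s.sort (· ≤ ·) = l at hs' hp hlen ⊢
  rw [← hs']
  match l, hlen with
  | x :: y :: t, _ =>
    refine ⟨x, y, ?_, ?_, ?_⟩
    · rw [← Multiset.cons_coe, ← Multiset.cons_coe, Multiset.insert_eq_cons,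
        Multiset.cons_le_cons_iff, Multiset.singleton_le]
      exact Multiset.mem_cons_self y _
    · simpa using (List.pairwise_cons.mp hp).1 y (by simp)
    · simp

section

variable {V : Type*} [Fintype V] [DecidableEq V]

/-- Comparing characteristic polynomials suffices to carry over the eigenvalues of a symmetric
matrix, with multiplicities. -/
theorem complexEigenvalues_eq_of_charpoly_eq {L M : Matrix V V ℝ} (hM : M.IsHermitian)
    (h : L.charpoly = M.charpoly) :
    complexEigenvalues L = (Finset.univ.val.map hM.eigenvalues).map (algebraMap ℝ ℂ) := by
  rw [complexEigenvalues, Matrix.charpoly_map, h, hM.splits_charpoly.roots_map,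
    hM.roots_charpoly_eq_eigenvalues]
  rfl

theorem hasRealSpectrum_of_charpoly_eq {L M : Matrix V V ℝ} (hM : M.IsHermitian)
    (h : L.charpoly = M.charpoly) : HasRealSpectrum L := by
  intro z hz
  rw [complexEigenvalues_eq_of_charpoly_eq hM h, Multiset.mem_map] at hz
  obtain ⟨x, -, rfl⟩ := hz
  simp

theorem sortedRealParts_eq_of_charpoly_eq {L M : Matrix V V ℝ} (hM : M.IsHermitian)
    (h : L.charpoly = M.charpoly) :
    sortedRealParts L = (Finset.univ.val.map hM.eigenvalues).sort (· ≤ ·) := by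
  rw [sortedRealParts, complexEigenvalues_eq_of_charpoly_eq hM h, Multiset.map_map]
  simp

theorem exists_eigenvalues_eq {M : Matrix V V ℝ} (hM : M.IsHermitian) {v : V → ℝ} {a : ℝ}
    (hv : v ≠ 0) (h : M.mulVec v = a • v) : ∃ i, hM.eigenvalues i = a := by
  rw [← Set.mem_range, ← hM.spectrum_real_eq_range_eigenvalues, ← Matrix.spectrum_toLin']
  exact (Module.End.hasEigenvalue_of_hasEigenvector
    (Module.End.hasEigenvector_iff.mpr ⟨Module.End.mem_eigenspace_iff.mpr h, hv⟩)).mem_spectrum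

/-- Two distinct eigenvalues with explicit eigenvectors bound the spectral gap from above. -/
theorem spectralGap_le_max {L M : Matrix V V ℝ} (hM : M.IsHermitian)
    (h : L.charpoly = M.charpoly) {v w : V → ℝ} {a b : ℝ} (hab : a ≠ b)
    (hv : v ≠ 0) (hva : M.mulVec v = a • v) (hw : w ≠ 0) (hwb : M.mulVec w = b • w) :
    spectralGap L ≤ max a b := by
  obtain ⟨i, hi⟩ := exists_eigenvalues_eq hM hv hva
  obtain ⟨j, hj⟩ := exists_eigenvalues_eq hM hw hwb
  rw [spectralGap, sortedRealParts_eq_of_charpoly_eq hM h]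
  apply Multiset.sort_getD_one_le
  rw [Multiset.le_iff_subset (by simp [hab])]
  intro x hx
  simp only [Multiset.insert_eq_cons, Multiset.mem_cons, Multiset.mem_singleton] at hx
  rcases hx with rfl | rfl
  · exact Multiset.mem_map_of_mem _ (Finset.mem_univ i) |> (hi ▸ ·)
  · exact Multiset.mem_map_of_mem _ (Finset.mem_univ j) |> (hj ▸ ·)

/-- The spectral gap is attained on a pair of linearly independent eigenvectors: if all eigenvectors
with eigenvalue in a down-set `P` are multiples of a single vector `e`, then the spectral gap lies
outside `P`. -/
theorem not_spectralGap_of_eigenvectors {L M : Matrix V V ℝ} (hM : M.IsHermitian)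
    (h : L.charpoly = M.charpoly) (hV : 2 ≤ Fintype.card V) (P : ℝ → Prop)
    (hP : ∀ x y, x ≤ y → P y → P x) (e : V → ℝ)
    (he : ∀ a (v : V → ℝ), P a → M.mulVec v = a • v → ∃ t : ℝ, v = t • e) :
    ¬ P (spectralGap L) := by
  intro hc
  rw [spectralGap, sortedRealParts_eq_of_charpoly_eq hM h] at hc
  obtain ⟨a, b, hab, ha, hb⟩ := Multiset.exists_pair_le_sort_getD_one
    (s := Finset.univ.val.map hM.eigenvalues) (by simpa using hV)
  have ha := hP _ _ ha hc
  have hb := hP _ _ hb hc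
  obtain ⟨i, -, hi⟩ := Multiset.mem_map.mp (Multiset.mem_of_le hab (a := a) (by simp))
  obtain ⟨s, hs⟩ := Multiset.exists_cons_of_mem (Finset.mem_univ_val i)
  rw [hs, Multiset.map_cons, hi, Multiset.insert_eq_cons, Multiset.cons_le_cons_iff,
    Multiset.singleton_le] at hab
  obtain ⟨j, hjs, hj⟩ := Multiset.mem_map.mp hab
  have hij : i ≠ j := by
    rintro rfl
    have := (Finset.univ : Finset V).nodup
    rw [hs, Multiset.nodup_cons] at this
    exact this.1 hjs
  obtain ⟨t, ht⟩ := he a _ ha (hi ▸ hM.mulVec_eigenvectorBasis i)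
  obtain ⟨u, hu⟩ := he b _ hb (hj ▸ hM.mulVec_eigenvectorBasis j)
  have h1 : hM.eigenvectorBasis i = t • WithLp.toLp 2 e := by
    ext k; exact congrFun ht k
  have h2 : hM.eigenvectorBasis j = u • WithLp.toLp 2 e := by
    ext k; exact congrFun hu k
  have h3 : u • hM.eigenvectorBasis i = t • hM.eigenvectorBasis j := by
    rw [h1, h2, smul_smul, smul_smul, mul_comm]
  have h4 := congrArg (inner ℝ (hM.eigenvectorBasis i)) h3
  have hu0 : u = 0 := by
    simpa [inner_smul_right, hM.eigenvectorBasis.orthonormal.2 hij,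
      hM.eigenvectorBasis.orthonormal.1 i] using h4
  have := hM.eigenvectorBasis.orthonormal.1 j
  rw [h2, hu0] at this
  simp at this

end

/-! ### Symmetrising the Laplacian of the cycle feeding the star -/

/-- The symmetric matrix obtained from `cycleStarLaplacian n m (s ^ 2)` by rescaling the coordinates
of the star by `s`: the two edges between node `0` of the cycle and the hub now have the same
weight `s`, while the diagonal is unchanged. -/
noncomputable def cycleStarSymm (n m : ℕ) [NeZero n] [NeZero m] (s : ℝ) :
    Matrix (Fin n ⊕ Fin m) (Fin n ⊕ Fin m) ℝ :=
  Matrix.fromBlocks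
    ((SimpleGraph.cycleGraph n).lapMatrix ℝ + Matrix.single 0 0 (s ^ 2)) (Matrix.single 0 0 (-s))
    (Matrix.single 0 0 (-s)) ((SimpleGraph.starGraph (0 : Fin m)).lapMatrix ℝ + Matrix.single 0 0 1)

/-- The null vector of the symmetrised Laplacian. -/
def cycleStarNull (n m : ℕ) (s : ℝ) : Fin n ⊕ Fin m → ℝ := Sum.elim (fun _ => 1) (fun _ => s)

theorem cycleStarNull_ne_zero (n m : ℕ) [NeZero n] (s : ℝ) : cycleStarNull n m s ≠ 0 := fun h => by
  simpa [cycleStarNull] using congrFun h (.inl 0)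

section

variable {n m : ℕ} [NeZero n] [NeZero m]

theorem digraphLaplacian_adjMatrix {V : Type*} [Fintype V] [DecidableEq V] (G : SimpleGraph V)
    [DecidableRel G.Adj] : digraphLaplacian (G.adjMatrix ℝ) = G.lapMatrix ℝ := by
  rw [digraphLaplacian, SimpleGraph.lapMatrix, SimpleGraph.degMatrix]
  congr 2
  ext i
  simp [SimpleGraph.degree_eq_sum_if_adj]

theorem cycleStarLaplacian_eq_fromBlocks (δ : ℝ) :
    cycleStarLaplacian n m δ = Matrix.fromBlocks
      ((SimpleGraph.cycleGraph n).lapMatrix ℝ + Matrix.single 0 0 δ) (Matrix.single 0 0 (-δ))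
      (Matrix.single 0 0 (-1))
      ((SimpleGraph.starGraph (0 : Fin m)).lapMatrix ℝ + Matrix.single 0 0 1) := by
  rw [← digraphLaplacian_adjMatrix, ← digraphLaplacian_adjMatrix]
  ext (i | i) (j | j)
  · simp only [cycleStarLaplacian, cycleStarAdj, digraphLaplacian, Matrix.sub_apply,
      Matrix.diagonal_apply, Fintype.sum_sum_type, Matrix.fromBlocks_apply₁₁,
      Matrix.fromBlocks_apply₁₂, Matrix.add_apply, Matrix.single_apply, Sum.inl.injEq]
    by_cases hi : 0 = i <;> by_cases hij : i = j <;> simp_all [SimpleGraph.adjMatrix_apply]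
  · simp [cycleStarLaplacian, cycleStarAdj, digraphLaplacian, Matrix.single_apply, neg_ite]
  · simp [cycleStarLaplacian, cycleStarAdj, digraphLaplacian, Matrix.single_apply, neg_ite]
  · simp only [cycleStarLaplacian, cycleStarAdj, digraphLaplacian, Matrix.sub_apply,
      Matrix.diagonal_apply, Fintype.sum_sum_type, Matrix.fromBlocks_apply₂₁,
      Matrix.fromBlocks_apply₂₂, Matrix.add_apply, Matrix.single_apply, Sum.inr.injEq]
    by_cases hi : 0 = i <;> by_cases hij : i = j <;> simp_all [SimpleGraph.adjMatrix_apply]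
    all_goals ring

theorem isHermitian_cycleStarSymm (s : ℝ) : (cycleStarSymm n m s).IsHermitian := by
  rw [cycleStarSymm, Matrix.isHermitian_fromBlocks_iff]
  refine ⟨.add (SimpleGraph.isHermitian_lapMatrix ..) ?_, ?_, ?_,
    .add (SimpleGraph.isHermitian_lapMatrix ..) ?_⟩ <;> simp [Matrix.IsHermitian]

/-- For `s ≠ 0` the matrices are similar through a diagonal matrix; for `s = 0` they only have the
same characteristic polynomial. -/
theorem charpoly_cycleStarLaplacian {s : ℝ} :
    (cycleStarLaplacian n m (s ^ 2)).charpoly = (cycleStarSymm n m s).charpoly := by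
  rw [cycleStarLaplacian_eq_fromBlocks, cycleStarSymm]
  rcases eq_or_ne s 0 with rfl | hs
  · -- Without the modification edge both matrices are block triangular.
    simp [Matrix.charpoly_fromBlocks_zero₁₂]
  · set D : Matrix (Fin n ⊕ Fin m) (Fin n ⊕ Fin m) ℝ := Matrix.fromBlocks 1 0 0 (s • 1) with hD
    set E : Matrix (Fin n ⊕ Fin m) (Fin n ⊕ Fin m) ℝ := Matrix.fromBlocks 1 0 0 (s⁻¹ • 1) with hE
    have h1 : E * D = 1 := by
      simp [hD, hE, Matrix.fromBlocks_multiply, hs]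
    rw [← mul_one (Matrix.fromBlocks _ (Matrix.single 0 0 (-s ^ 2)) _ _), ← h1, ← mul_assoc,
      Matrix.charpoly_mul_comm]
    congr 1
    simp [hD, hE, Matrix.fromBlocks_multiply, hs, Matrix.smul_single, sq]

theorem cycleStarSymm_mulVec_inl (s : ℝ) (v : Fin n ⊕ Fin m → ℝ) (i : Fin n) :
    (cycleStarSymm n m s).mulVec v (.inl i) =
      ((SimpleGraph.cycleGraph n).lapMatrix ℝ).mulVec (v ∘ .inl) i +
        if i = 0 then s * (s * v (.inl 0) - v (.inr 0)) else 0 := by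
  rw [cycleStarSymm, Matrix.fromBlocks_mulVec, Sum.elim_inl, Matrix.add_mulVec,
    Matrix.single_mulVec, Matrix.single_mulVec]
  by_cases h : i = 0
  · subst h; simp; ring
  · simp [h]

theorem cycleStarSymm_mulVec_inr (s : ℝ) (v : Fin n ⊕ Fin m → ℝ) (i : Fin m) :
    (cycleStarSymm n m s).mulVec v (.inr i) =
      ((SimpleGraph.starGraph (0 : Fin m)).lapMatrix ℝ).mulVec (v ∘ .inr) i -
        if i = 0 then s * v (.inl 0) - v (.inr 0) else 0 := by
  rw [cycleStarSymm, Matrix.fromBlocks_mulVec, Sum.elim_inr, Matrix.add_mulVec,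
    Matrix.single_mulVec, Matrix.single_mulVec]
  by_cases h : i = 0
  · subst h; simp; ring
  · simp [h]

/-- The quadratic form of the symmetrised Laplacian is the sum of those of the cycle and of the star
and of the square of a linear form. -/
theorem dotProduct_cycleStarSymm_mulVec (s : ℝ) (v : Fin n ⊕ Fin m → ℝ) :
    v ⬝ᵥ (cycleStarSymm n m s).mulVec v =
      (v ∘ .inl) ⬝ᵥ ((SimpleGraph.cycleGraph n).lapMatrix ℝ).mulVec (v ∘ .inl) +
      (v ∘ .inr) ⬝ᵥ ((SimpleGraph.starGraph (0 : Fin m)).lapMatrix ℝ).mulVec (v ∘ .inr) +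
      (s * v (.inl 0) - v (.inr 0)) ^ 2 := by
  simp only [dotProduct, Fintype.sum_sum_type, cycleStarSymm_mulVec_inl, cycleStarSymm_mulVec_inr,
    mul_add, mul_sub, Finset.sum_add_distrib, Finset.sum_sub_distrib, mul_ite, mul_zero,
    Finset.sum_ite_eq', Finset.mem_univ, if_true, Function.comp_apply]
  ring

theorem cycleStarSymm_eigenvalue_nonneg {s a : ℝ} {v : Fin n ⊕ Fin m → ℝ} (hv : v ≠ 0)
    (h : (cycleStarSymm n m s).mulVec v = a • v) : 0 ≤ a := by
  have h1 := dotProduct_cycleStarSymm_mulVec s v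
  rw [h, dotProduct_smul, smul_eq_mul] at h1
  have h2 := (SimpleGraph.posSemidef_lapMatrix ℝ (SimpleGraph.cycleGraph n)).dotProduct_mulVec_nonneg
    (v ∘ .inl)
  have h3 := (SimpleGraph.posSemidef_lapMatrix ℝ
    (SimpleGraph.starGraph (0 : Fin m))).dotProduct_mulVec_nonneg (v ∘ .inr)
  rw [star_trivial] at h2 h3
  have h4 : 0 < v ⬝ᵥ v := by
    have := Matrix.dotProduct_star_self_pos_iff.mpr hv
    rwa [star_trivial] at this
  by_contra hlt
  have := mul_neg_of_neg_of_pos (not_le.mp hlt) h4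
  have := sq_nonneg (s * v (.inl 0) - v (.inr 0))
  linarith

theorem cycleStarSymm_mulVec_null (s : ℝ) :
    (cycleStarSymm n m s).mulVec (cycleStarNull n m s) = (0 : ℝ) • cycleStarNull n m s := by
  have hc (k : ℕ) (G : SimpleGraph (Fin k)) [DecidableRel G.Adj] (c : ℝ) :
      (G.lapMatrix ℝ).mulVec (fun _ => c) = 0 := by
    rw [SimpleGraph.lapMatrix_mulVec_eq_zero_iff_forall_adj]
    simp
  have h1 : cycleStarNull n m s ∘ Sum.inl = fun _ => 1 := rfl
  have h2 : cycleStarNull n m s ∘ Sum.inr = fun _ => s := rfl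
  ext (i | i)
  · rw [cycleStarSymm_mulVec_inl, h1, hc]
    simp [cycleStarNull]
  · rw [cycleStarSymm_mulVec_inr, h2, hc]
    simp [cycleStarNull]

/-- The kernel is one-dimensional because both graphs are connected and coupled by the linear
form `s x₀ - y₀`. -/
theorem eq_smul_cycleStarNull {s : ℝ} {v : Fin n ⊕ Fin m → ℝ}
    (h : (cycleStarSymm n m s).mulVec v = 0) : v = v (.inl 0) • cycleStarNull n m s := by
  have h1 := dotProduct_cycleStarSymm_mulVec s v
  rw [h, dotProduct_zero] at h1
  have p2 := SimpleGraph.posSemidef_lapMatrix ℝ (SimpleGraph.cycleGraph n)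
  have p3 := SimpleGraph.posSemidef_lapMatrix ℝ (SimpleGraph.starGraph (0 : Fin m))
  have h2 := p2.dotProduct_mulVec_nonneg (v ∘ .inl)
  have h3 := p3.dotProduct_mulVec_nonneg (v ∘ .inr)
  rw [star_trivial] at h2 h3
  have h4 := sq_nonneg (s * v (.inl 0) - v (.inr 0))
  have e2 := (p2.dotProduct_mulVec_zero_iff (v ∘ .inl)).mp (by rw [star_trivial]; linarith)
  have e3 := (p3.dotProduct_mulVec_zero_iff (v ∘ .inr)).mp (by rw [star_trivial]; linarith)
  rw [SimpleGraph.lapMatrix_mulVec_eq_zero_iff_forall_reachable] at e2 e3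
  have e4 : s * v (.inl 0) - v (.inr 0) = 0 := by
    apply pow_eq_zero_iff (two_ne_zero) |>.mp; linarith
  ext (i | i)
  · simpa [cycleStarNull] using e2 i 0 (SimpleGraph.cycleGraph_preconnected i 0)
  · have := e3 i 0 ((SimpleGraph.connected_starGraph (0 : Fin m)).preconnected i 0)
    simp only [Function.comp_apply] at this
    simp only [cycleStarNull, Pi.smul_apply, Sum.elim_inr, smul_eq_mul]
    linarith

/-! ### The Laplacians of the cycle and of the star -/

/-- The Laplacian of the cycle at node `0`, for a vector read off from a sequence
indexed by `ℕ`, so that the neighbours need no arithmetic modulo `n`. -/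
theorem cycleGraph_lapMatrix_mulVec_zero (hn : 3 ≤ n) (x : Fin n → ℝ) (X : ℕ → ℝ)
    (hx : ∀ i : Fin n, x i = X i) :
    ((SimpleGraph.cycleGraph n).lapMatrix ℝ).mulVec x 0 = 2 * X 0 - X 1 - X (n - 1) := by
  obtain ⟨k, rfl⟩ := Nat.exists_eq_add_of_le' hn
  have h2 : (0 - 1 : Fin (k + 3)) ≠ 0 + 1 := by
    simp [Fin.ext_iff, Fin.val_neg]
  rw [SimpleGraph.lapMatrix_mulVec_apply, SimpleGraph.cycleGraph_degree_three_le,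
    SimpleGraph.cycleGraph_neighborFinset, Finset.sum_pair h2]
  simp [hx, Fin.val_neg]
  ring

theorem cycleGraph_lapMatrix_mulVec_of_ne_zero (hn : 3 ≤ n) (x : Fin n → ℝ) (X : ℕ → ℝ)
    (hx : ∀ i : Fin n, x i = X i) (hX : X n = X 0) {i : Fin n} (hi : i ≠ 0) :
    ((SimpleGraph.cycleGraph n).lapMatrix ℝ).mulVec x i = 2 * X i - X (i + 1) - X (i - 1) := by
  obtain ⟨k, rfl⟩ := Nat.exists_eq_add_of_le' hn
  have h2 : i - 1 ≠ i + 1 := by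
    rw [Ne, sub_eq_iff_eq_add, add_assoc, left_eq_add]
    exact ne_of_beq_false rfl
  have hv : (i : ℕ) ≠ 0 := fun h => hi (Fin.ext h)
  have h3 : X ((i - 1 : Fin (k + 3)) : ℕ) = X (i - 1) := by
    rw [Fin.val_sub_one_of_ne_zero hi]
  have h4 : X ((i + 1 : Fin (k + 3)) : ℕ) = X (i + 1) := by
    rw [Fin.val_add_one]
    split_ifs with h
    · simp [h, ← hX]
    · rfl
  rw [SimpleGraph.lapMatrix_mulVec_apply, SimpleGraph.cycleGraph_degree_three_le,
    SimpleGraph.cycleGraph_neighborFinset, Finset.sum_pair h2, hx, hx, hx, h3, h4]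
  push_cast
  ring

theorem starGraph_lapMatrix_mulVec_hub (y : Fin m → ℝ) :
    ((SimpleGraph.starGraph (0 : Fin m)).lapMatrix ℝ).mulVec y 0 =
      ((m : ℝ) - 1) * y 0 - ∑ i ∈ Finset.univ.erase 0, y i := by
  have h : (SimpleGraph.starGraph (0 : Fin m)).neighborFinset 0 = Finset.univ.erase 0 := by
    ext i
    simp [eq_comm]
  rw [SimpleGraph.lapMatrix_mulVec_apply, SimpleGraph.degree_starGraph_center, h,
    Fintype.card_fin, Nat.cast_pred (Nat.pos_of_neZero m)]

theorem starGraph_lapMatrix_mulVec_leaf (y : Fin m → ℝ) {i : Fin m} (hi : i ≠ 0) :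
    ((SimpleGraph.starGraph (0 : Fin m)).lapMatrix ℝ).mulVec y i = y i - y 0 := by
  have h : (SimpleGraph.starGraph (0 : Fin m)).neighborFinset i = {0} := by
    ext j
    simp only [SimpleGraph.mem_neighborFinset, SimpleGraph.starGraph_adj, Finset.mem_singleton]
    grind
  rw [SimpleGraph.lapMatrix_mulVec_apply, SimpleGraph.degree_starGraph_of_ne_center hi, h]
  simp

end

/-! ### Eigenvectors as trigonometric waves -/

/-- Solutions of the recurrence `X (j + 1) + X (j - 1) = 2 cos θ X j` in terms of `X 0`, `X 1`. -/
theorem sin_mul_eq_of_recurrence {X : ℕ → ℝ} {θ : ℝ} {n : ℕ}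
    (hX : ∀ j, j + 1 < n → X (j + 2) = 2 * Real.cos θ * X (j + 1) - X j) :
    ∀ j ≤ n, Real.sin θ * X j = X 1 * Real.sin (j * θ) - X 0 * Real.sin (j * θ - θ) := by
  intro j
  induction j using Nat.twoStepInduction with
  | zero => simp [mul_comm]
  | one => simp [mul_comm]
  | more j h1 h2 =>
    intro hj
    have e1 := h1 (by omega)
    have e2 := h2 (by omega)
    rw [hX j (by omega)]
    have s1 : Real.sin (((j + 2 : ℕ) : ℝ) * θ) =
        2 * Real.cos θ * Real.sin (((j + 1 : ℕ) : ℝ) * θ) - Real.sin (j * θ) := by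
      have a : ((j + 2 : ℕ) : ℝ) * θ = ((j + 1 : ℕ) : ℝ) * θ + θ := by push_cast; ring
      have b : (j : ℝ) * θ = ((j + 1 : ℕ) : ℝ) * θ - θ := by push_cast; ring
      rw [a, b, Real.sin_add, Real.sin_sub]
      ring
    have s2 : Real.sin (((j + 2 : ℕ) : ℝ) * θ - θ) =
        2 * Real.cos θ * Real.sin (((j + 1 : ℕ) : ℝ) * θ - θ) - Real.sin (j * θ - θ) := by
      have a : ((j + 2 : ℕ) : ℝ) * θ - θ = (((j + 1 : ℕ) : ℝ) * θ - θ) + θ := by push_cast; ring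
      have b : (j : ℝ) * θ - θ = (((j + 1 : ℕ) : ℝ) * θ - θ) - θ := by push_cast; ring
      rw [a, b]
      generalize ((j + 1 : ℕ) : ℝ) * θ - θ = t
      rw [Real.sin_add, Real.sin_sub]
      ring
    rw [s1, s2]
    linear_combination 2 * Real.cos θ * e2 - e1

/-- A solution of the recurrence on the arc `0, …, n` with `X n = X 0` is symmetric under the
reflection `j ↦ n - j` unless `sin (n θ / 2) = 0`. -/
theorem symmetric_of_recurrence {X : ℕ → ℝ} {θ : ℝ} {n : ℕ} (hn : 1 ≤ n)
    (hX : ∀ j, j + 1 < n → X (j + 2) = 2 * Real.cos θ * X (j + 1) - X j) (hp : X n = X 0)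
    (hθ : Real.sin θ ≠ 0) (hφ : Real.sin (n * θ / 2) ≠ 0) :
    X 0 * Real.cos (n * θ / 2 - θ) = X 1 * Real.cos (n * θ / 2) ∧ X (n - 1) = X 1 := by
  have e1 := sin_mul_eq_of_recurrence hX n le_rfl
  have e2 := sin_mul_eq_of_recurrence hX (n - 1) (by omega)
  rw [Nat.cast_pred hn] at e2
  set φ := n * θ / 2 with hφd
  have a1 : (n : ℝ) * θ = 2 * φ := by rw [hφd]; ring
  have a2 : ((n : ℝ) - 1) * θ = 2 * φ - θ := by rw [hφd]; ring
  rw [a1, hp] at e1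
  rw [a2, sub_sub] at e2
  have t1 : Real.sin (2 * φ - θ) = Real.sin φ * Real.cos (φ - θ) + Real.cos φ * Real.sin (φ - θ) := by
    rw [← Real.sin_add]; ring_nf
  have t2 : Real.sin θ = Real.sin φ * Real.cos (φ - θ) - Real.cos φ * Real.sin (φ - θ) := by
    rw [← Real.sin_sub]; ring_nf
  have t3 : Real.sin (2 * φ - (θ + θ)) = 2 * Real.sin (φ - θ) * Real.cos (φ - θ) := by
    rw [← Real.sin_two_mul]; ring_nf
  have k1 : X 0 * Real.cos (φ - θ) = X 1 * Real.cos φ := by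
    apply mul_left_cancel₀ (mul_ne_zero two_ne_zero hφ)
    rw [t1, Real.sin_two_mul] at e1
    linear_combination e1 - X 0 * t2
  refine ⟨k1, mul_left_cancel₀ hθ ?_⟩
  rw [e2, t3, t1]
  linear_combination X 1 * (-t2) - 2 * Real.sin (φ - θ) * k1

section

variable {n m : ℕ} [NeZero n] [NeZero m]

/-- The equations satisfied by an eigenvector `v` with eigenvalue `2 - 2 cos θ`, once the nodes of
the cycle other than `0` and its neighbour and the leaves are eliminated, and the fact that the
three remaining coordinates determine `v`. -/
theorem eigenvector_equations {s θ : ℝ} {v : Fin n ⊕ Fin m → ℝ} (hn : 3 ≤ n)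
    (hθ : Real.sin θ ≠ 0) (hφ : Real.sin (n * θ / 2) ≠ 0)
    (h : (cycleStarSymm n m s).mulVec v = (2 - 2 * Real.cos θ) • v) :
    ∃ x₀ x₁ y₀ : ℝ,
      x₀ * Real.cos (n * θ / 2 - θ) = x₁ * Real.cos (n * θ / 2) ∧
      2 * Real.cos θ * x₀ - 2 * x₁ + s * (s * x₀ - y₀) = 0 ∧
      ((2 - 2 * Real.cos θ) ^ 2 - (m + 1) * (2 - 2 * Real.cos θ) + 1) * y₀ =
        (1 - (2 - 2 * Real.cos θ)) * s * x₀ ∧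
      (2 - 2 * Real.cos θ ≠ 1 → x₀ = 0 → x₁ = 0 → y₀ = 0 → v = 0) := by
  set X : ℕ → ℝ := fun j => v (.inl (Fin.ofNat n j)) with hXd
  have hx : ∀ i : Fin n, (v ∘ .inl) i = X i := fun i => by simp [hXd]
  have hp : X n = X 0 := by simp [hXd, Fin.ofNat]
  have hX : ∀ j, j + 1 < n → X (j + 2) = 2 * Real.cos θ * X (j + 1) - X j := by
    intro j hj
    have hi : (⟨j + 1, hj⟩ : Fin n) ≠ 0 := by simp [Fin.ext_iff]
    have := congrFun h (.inl ⟨j + 1, hj⟩)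
    rw [cycleStarSymm_mulVec_inl, if_neg hi, cycleGraph_lapMatrix_mulVec_of_ne_zero hn _ X hx hp hi,
      Pi.smul_apply, smul_eq_mul] at this
    have hv := hx ⟨j + 1, hj⟩
    simp only [Function.comp_apply] at hv
    rw [hv] at this
    simp only [Nat.add_sub_cancel] at this
    linarith
  obtain ⟨k1, k2⟩ := symmetric_of_recurrence (by omega) hX hp hθ hφ
  have hv0 : v (.inl 0) = X 0 := by simpa using hx 0
  have k3 := congrFun h (.inl 0)
  rw [cycleStarSymm_mulVec_inl, if_pos rfl, cycleGraph_lapMatrix_mulVec_zero hn _ X hx, k2,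
    Pi.smul_apply, smul_eq_mul, hv0] at k3
  have k4 := congrFun h (.inr 0)
  rw [cycleStarSymm_mulVec_inr, if_pos rfl, starGraph_lapMatrix_mulVec_hub,
    Pi.smul_apply, smul_eq_mul, hv0] at k4
  have k5 : ∀ i : Fin m, i ≠ 0 →
      (1 - (2 - 2 * Real.cos θ)) * v (.inr i) = v (.inr 0) := by
    intro i hi
    have := congrFun h (.inr i)
    rw [cycleStarSymm_mulVec_inr, if_neg hi, starGraph_lapMatrix_mulVec_leaf _ hi,
      Pi.smul_apply, smul_eq_mul, Function.comp_apply, Function.comp_apply] at this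
    linarith
  have k6 : (1 - (2 - 2 * Real.cos θ)) * ∑ i ∈ Finset.univ.erase (0 : Fin m), v (.inr i) =
      ((m : ℝ) - 1) * v (.inr 0) := by
    rw [Finset.mul_sum, Finset.sum_congr rfl fun i hi => k5 i (Finset.ne_of_mem_erase hi)]
    simp [Finset.card_erase_of_mem, Nat.cast_pred (Nat.pos_of_neZero m)]
  refine ⟨X 0, X 1, v (.inr 0), k1, by linarith, ?_, ?_⟩
  · simp only [Function.comp_apply] at k4
    linear_combination (1 - (2 - 2 * Real.cos θ)) * k4 + k6
  · intro h1 h2 h3 h4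
    ext (i | i)
    · have := sin_mul_eq_of_recurrence hX i i.isLt.le
      rw [h2, h3] at this
      have hi := hx i
      rw [Function.comp_apply] at hi
      rw [hi]
      simpa [hθ] using this
    · rcases eq_or_ne i 0 with rfl | hi
      · exact h4
      · have := k5 i hi
        rw [h4] at this
        exact (mul_eq_zero.mp this).resolve_left (sub_ne_zero.mpr h1.symm)

/-- For `s = 0` the characteristic equation is a product of nonzero factors. -/
theorem eigenvector_eq_zero_of_uncoupled {θ : ℝ} {v : Fin n ⊕ Fin m → ℝ} (hn : 3 ≤ n)
    (hθ : Real.sin θ ≠ 0) (hφ : Real.sin (n * θ / 2) ≠ 0) (h1 : 2 - 2 * Real.cos θ ≠ 1)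
    (hr : (2 - 2 * Real.cos θ) ^ 2 - (m + 1) * (2 - 2 * Real.cos θ) + 1 ≠ 0)
    (h : (cycleStarSymm n m 0).mulVec v = (2 - 2 * Real.cos θ) • v) : v = 0 := by
  obtain ⟨x₀, x₁, y₀, e1, e2, e3, e4⟩ := eigenvector_equations hn hθ hφ h
  rw [Real.cos_sub] at e1
  have hx : x₀ = 0 := by
    have : Real.sin (n * θ / 2) * Real.sin θ * x₀ = 0 := by
      linear_combination e1 - Real.cos (n * θ / 2) / 2 * e2
    simpa [hθ, hφ] using this
  refine e4 h1 hx ?_ ?_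
  · rw [hx] at e2; linarith
  · simpa [hr] using e3

/-- For `cos (n θ / 2) > 0` and `λ ≤ β⁻` both terms of the characteristic equation are nonnegative,
and the second one is positive. -/
theorem eigenvector_eq_zero_of_cos_pos {s θ : ℝ} {v : Fin n ⊕ Fin m → ℝ} (hn : 3 ≤ n) (hm : 4 ≤ m)
    (hs : s ≠ 0) (hθ : 0 < Real.sin θ) (hφ : 0 < Real.sin (n * θ / 2))
    (hφ' : 0 < Real.cos (n * θ / 2)) (h0 : 0 < 2 - 2 * Real.cos θ) (h1 : 2 - 2 * Real.cos θ < 1)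
    (hr : 0 ≤ (2 - 2 * Real.cos θ) ^ 2 - (m + 1) * (2 - 2 * Real.cos θ) + 1)
    (h : (cycleStarSymm n m s).mulVec v = (2 - 2 * Real.cos θ) • v) : v = 0 := by
  obtain ⟨x₀, x₁, y₀, e1, e2, e3, e4⟩ := eigenvector_equations hn hθ.ne' hφ.ne' h
  rw [Real.cos_sub] at e1
  set l := 2 - 2 * Real.cos θ with hl
  set r := l ^ 2 - (m + 1) * l + 1 with hrd
  have hm' : (4 : ℝ) ≤ m := by exact_mod_cast hm
  have hx : x₀ = 0 := by
    have key : (2 * Real.sin (n * θ / 2) * Real.sin θ * r +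
        Real.cos (n * θ / 2) * s ^ 2 * (l * (m - l))) * x₀ = 0 := by
      linear_combination 2 * r * e1 - Real.cos (n * θ / 2) * r * e2
        - Real.cos (n * θ / 2) * s * e3
    refine (mul_eq_zero.mp key).resolve_left (ne_of_gt ?_)
    have : 0 < (m : ℝ) - l := by linarith
    positivity
  have hx1 : x₁ = 0 := by
    rw [hx, zero_mul, zero_eq_mul] at e1
    exact e1.resolve_right hφ'.ne'
  refine e4 h1.ne hx hx1 ?_
  rw [hx, hx1] at e2
  simpa [hs] using e2

/-- The wave that is symmetric about the node of the cycle opposite to `0`, glued to the star,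
is an eigenvector as soon as the equation at node `0` holds. -/
theorem exists_eigenvector_of_characteristic_eq {s θ : ℝ} (hn : 3 ≤ n) (hm : 4 ≤ m)
    (hs : s ≠ 0) (hφ : Real.cos (n * θ / 2) ≠ 0)
    (h : 2 * Real.sin (n * θ / 2) * Real.sin θ *
        ((2 - 2 * Real.cos θ) ^ 2 - (m + 1) * (2 - 2 * Real.cos θ) + 1) +
      Real.cos (n * θ / 2) * s ^ 2 * ((2 - 2 * Real.cos θ) * (m - (2 - 2 * Real.cos θ))) = 0) :
    ∃ v : Fin n ⊕ Fin m → ℝ, v ≠ 0 ∧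
      (cycleStarSymm n m s).mulVec v = (2 - 2 * Real.cos θ) • v := by
  set l := 2 - 2 * Real.cos θ with hl
  set r := l ^ 2 - (m + 1) * l + 1 with hr
  set φ := n * θ / 2 with hφd
  set X : ℕ → ℝ := fun j => r * Real.cos (j * θ - φ) with hX
  have hp : X n = X 0 := by
    have : (n : ℝ) * θ - φ = φ := by rw [hφd]; ring
    simp [hX, this]
  set v : Fin n ⊕ Fin m → ℝ := Sum.elim (fun i => X i)
    (fun i => if i = 0 then (1 - l) * s * Real.cos φ else s * Real.cos φ) with hv
  have hx : ∀ i : Fin n, (v ∘ .inl) i = X i := fun i => rfl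
  have hv0 : v (.inl 0) = X 0 := by simp [hv]
  have hX0 : X 0 = r * Real.cos φ := by simp [hX]
  have hy0 : v (.inr 0) = (1 - l) * s * Real.cos φ := by simp [hv]
  have hyi : ∀ i : Fin m, i ≠ 0 → v (.inr i) = s * Real.cos φ := fun i hi => by simp [hv, hi]
  refine ⟨v, fun h0 => ?_, ?_⟩
  · have h1 : (⟨1, by omega⟩ : Fin m) ≠ 0 := by simp [Fin.ext_iff]
    have := hyi _ h1
    rw [h0] at this
    simp [hs, hφ] at this
  ext (i | i)
  · rw [cycleStarSymm_mulVec_inl, Pi.smul_apply, smul_eq_mul]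
    rcases eq_or_ne i 0 with rfl | hi
    · have h1 : X 1 = r * Real.cos (φ - θ) := by
        simp only [hX, Nat.cast_one, one_mul]; rw [← Real.cos_neg]; ring_nf
      have h2 : X (n - 1) = r * Real.cos (φ - θ) := by
        simp only [hX]
        rw [Nat.cast_pred (by omega), hφd]; ring_nf
      rw [if_pos rfl, cycleGraph_lapMatrix_mulVec_zero hn _ X hx, h1, h2, hv0, hX0, hy0,
        Real.cos_sub]
      linear_combination -h + r * Real.cos φ * (-hl) - s ^ 2 * Real.cos φ * (-hr)
    · rw [if_neg hi, cycleGraph_lapMatrix_mulVec_of_ne_zero hn _ X hx hp hi]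
      have hi' : 0 < (i : ℕ) := Nat.pos_of_ne_zero fun h => hi (Fin.ext h)
      have h3 : v (.inl i) = X i := rfl
      have h4 : X (i + 1) = r * Real.cos (((i : ℕ) * θ - φ) + θ) := by
        simp only [hX]; push_cast; ring_nf
      have h5 : X (i - 1) = r * Real.cos (((i : ℕ) * θ - φ) - θ) := by
        simp only [hX]; rw [Nat.cast_pred hi']; ring_nf
      have h6 : X i = r * Real.cos ((i : ℕ) * θ - φ) := rfl
      rw [h3, h4, h5, h6, Real.cos_add, Real.cos_sub _ θ, hl]
      ring
  · rw [cycleStarSymm_mulVec_inr, Pi.smul_apply, smul_eq_mul]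
    rcases eq_or_ne i 0 with rfl | hi
    · rw [if_pos rfl, starGraph_lapMatrix_mulVec_hub]
      simp only [Function.comp_apply]
      rw [Finset.sum_congr rfl fun i hi => hyi i (Finset.ne_of_mem_erase hi),
        hv0, hX0, hy0, Finset.sum_const, Finset.card_erase_of_mem (Finset.mem_univ _),
        Finset.card_univ, Fintype.card_fin, nsmul_eq_mul, Nat.cast_pred (by omega)]
      linear_combination s * Real.cos φ * (-hr)
    · rw [if_neg hi, starGraph_lapMatrix_mulVec_leaf _ hi, Function.comp_apply,
        Function.comp_apply, hyi i hi, hy0]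
      ring

/-- In the unmodified graph, an eigenvector supported on the star. -/
theorem exists_eigenvector_uncoupled {b : ℝ} (hm : 4 ≤ m) (hb : b ^ 2 - (m + 1) * b + 1 = 0) :
    ∃ v : Fin n ⊕ Fin m → ℝ, v ≠ 0 ∧ (cycleStarSymm n m 0).mulVec v = b • v := by
  set v : Fin n ⊕ Fin m → ℝ := Sum.elim 0 (fun i => if i = 0 then 1 - b else 1) with hv
  have hv0 : v ∘ .inl = 0 := rfl
  have hy0 : v (.inr 0) = 1 - b := by simp [hv]
  have hyi : ∀ i : Fin m, i ≠ 0 → v (.inr i) = 1 := fun i hi => by simp [hv, hi]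
  refine ⟨v, fun h0 => ?_, ?_⟩
  · have h1 : (⟨1, by omega⟩ : Fin m) ≠ 0 := by simp [Fin.ext_iff]
    have := hyi _ h1
    rw [h0] at this
    simp at this
  ext (i | i)
  · rw [cycleStarSymm_mulVec_inl, hv0]
    simp [hv]
  · rw [cycleStarSymm_mulVec_inr, Pi.smul_apply, smul_eq_mul]
    rcases eq_or_ne i 0 with rfl | hi
    · rw [if_pos rfl, starGraph_lapMatrix_mulVec_hub]
      simp only [Function.comp_apply]
      rw [Finset.sum_congr rfl fun i hi => hyi i (Finset.ne_of_mem_erase hi),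
        hy0, Finset.sum_const, Finset.card_erase_of_mem (Finset.mem_univ _),
        Finset.card_univ, Fintype.card_fin, nsmul_eq_mul, Nat.cast_pred (by omega)]
      linear_combination hb
    · rw [if_neg hi, starGraph_lapMatrix_mulVec_leaf _ hi, Function.comp_apply,
        Function.comp_apply, hyi i hi, hy0]
      ring

end

/-! ### The critical numbers -/

section

variable {n m : ℕ}

theorem starBetaMinus_isRoot (hm : 4 ≤ m) :
    starBetaMinus m 1 ^ 2 - (m + 1) * starBetaMinus m 1 + 1 = 0 := by
  have hm' : (4 : ℝ) ≤ m := by exact_mod_cast hm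
  have h := Real.sq_sqrt (show (0 : ℝ) ≤ ((m : ℝ) + 1) ^ 2 - 4 * 1 by nlinarith)
  rw [starBetaMinus]
  linear_combination h / 4

theorem starBetaMinus_pos (hm : 4 ≤ m) : 0 < starBetaMinus m 1 := by
  have hm' : (4 : ℝ) ≤ m := by exact_mod_cast hm
  have h : √(((m : ℝ) + 1) ^ 2 - 4 * 1) < m + 1 :=
    (Real.sqrt_lt' (by linarith)).mpr (by linarith)
  exact half_pos (sub_pos.mpr h)

theorem starBetaMinus_lt_one (hm : 4 ≤ m) : starBetaMinus m 1 < 1 := by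
  have hm' : (4 : ℝ) ≤ m := by exact_mod_cast hm
  have h : (m : ℝ) + 1 - 2 < √(((m : ℝ) + 1) ^ 2 - 4 * 1) :=
    Real.lt_sqrt_of_sq_lt (by nlinarith)
  rw [starBetaMinus, div_lt_one two_pos]
  exact sub_lt_comm.mp h

theorem pos_of_lt_starBetaMinus (hm : 4 ≤ m) {l : ℝ} (hl : l < starBetaMinus m 1) :
    0 < l ^ 2 - (m + 1) * l + 1 := by
  have hm' : (4 : ℝ) ≤ m := by exact_mod_cast hm
  have h1 := starBetaMinus_lt_one hm
  have h2 : l ^ 2 - (m + 1) * l + 1 =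
      (starBetaMinus m 1 - l) * (m + 1 - starBetaMinus m 1 - l) := by
    linear_combination starBetaMinus_isRoot hm
  rw [h2]
  exact mul_pos (by linarith) (by linarith)

/-- Every number in `(0, 4)` is of the form `2 - 2 cos θ` with `0 < θ < π`. -/
theorem exists_angle {l : ℝ} (h0 : 0 < l) (h4 : l < 4) :
    ∃ θ, 0 < θ ∧ θ < Real.pi ∧ 2 - 2 * Real.cos θ = l := by
  refine ⟨Real.arccos (1 - l / 2), Real.arccos_pos.mpr (by linarith), ?_, ?_⟩
  · exact (Real.arccos_le_pi _).lt_of_ne fun h => by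
      rw [Real.arccos_eq_pi] at h; linarith
  · rw [Real.cos_arccos (by linarith) (by linarith)]; ring

theorem cycleAlpha_eq (n l : ℕ) :
    cycleAlpha n l = 2 - 2 * Real.cos ((l : ℝ) * Real.pi / (n : ℝ)) := by
  rw [cycleAlpha]; ring

theorem angle_mem_Icc {l : ℕ} (hn : 0 < n) (hl : l ≤ n) :
    (l : ℝ) * Real.pi / (n : ℝ) ∈ Set.Icc 0 Real.pi := by
  have hn' : (0 : ℝ) < n := by exact_mod_cast hn
  have hl' : (l : ℝ) ≤ n := by exact_mod_cast hl
  have := Real.pi_pos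
  refine ⟨by positivity, ?_⟩
  rw [div_le_iff₀ hn', mul_comm Real.pi]
  gcongr

/-- The comparison with `α_l` in terms of the half angle `n θ / 2` of the characteristic equation. -/
theorem lt_cycleAlpha_iff {l : ℕ} {θ : ℝ} (hn : 0 < n) (hl : l ≤ n) (h0 : 0 ≤ θ)
    (hπ : θ ≤ Real.pi) : 2 - 2 * Real.cos θ < cycleAlpha n l ↔ n * θ / 2 < l * (Real.pi / 2) := by
  have hn' : (0 : ℝ) < n := by exact_mod_cast hn
  rw [cycleAlpha_eq, sub_lt_sub_iff_left, mul_lt_mul_iff_right₀ two_pos,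
    Real.strictAntiOn_cos.lt_iff_gt (angle_mem_Icc hn hl) ⟨h0, hπ⟩, lt_div_iff₀ hn']
  constructor <;> intro h <;> linarith

theorem cycleAlpha_one_lt_two (hn : 3 ≤ n) : cycleAlpha n 1 < cycleAlpha n 2 := by
  have h := angle_mem_Icc (n := n) (l := 1) (by omega) (by omega)
  have hn' : (0 : ℝ) < n := by exact_mod_cast (by omega : 0 < n)
  rw [cycleAlpha_eq n 1, lt_cycleAlpha_iff (by omega) (by omega) h.1 h.2]
  have := Real.pi_pos
  push_cast
  field_simp
  norm_num

end

/-! ### Bounds for the spectral gap -/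

section

variable {n m : ℕ} [NeZero n] [NeZero m]

/-- If there is no eigenvalue in the interval that consists of the positive elements of the down-set
`P`, then the spectral gap is not in `P`, since `0` is a simple eigenvalue of the symmetrisation. -/
theorem not_spectralGap_cycleStar (hm : 4 ≤ m) (s : ℝ) (P : ℝ → Prop)
    (hP : ∀ x y, x ≤ y → P y → P x)
    (h : ∀ a (v : Fin n ⊕ Fin m → ℝ), P a → 0 < a →
      (cycleStarSymm n m s).mulVec v = a • v → v = 0) :
    ¬ P (spectralGap (cycleStarLaplacian n m (s ^ 2))) := by
  refine not_spectralGap_of_eigenvectors (isHermitian_cycleStarSymm s) charpoly_cycleStarLaplacian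
    (by simp; omega) P hP (cycleStarNull n m s) fun a v ha hv => ?_
  rcases eq_or_ne v 0 with rfl | hv0
  · exact ⟨0, by simp⟩
  rcases (cycleStarSymm_eigenvalue_nonneg hv0 hv).eq_or_lt with rfl | hpos
  · exact ⟨_, eq_smul_cycleStarNull (by simpa using hv)⟩
  · exact absurd (h a v ha hpos hv) hv0

theorem spectralGap_cycleStar_le {s a : ℝ} {v : Fin n ⊕ Fin m → ℝ} (ha : 0 < a) (hv : v ≠ 0)
    (h : (cycleStarSymm n m s).mulVec v = a • v) :
    spectralGap (cycleStarLaplacian n m (s ^ 2)) ≤ a := by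
  have := spectralGap_le_max (isHermitian_cycleStarSymm s) charpoly_cycleStarLaplacian ha.ne
    (cycleStarNull_ne_zero n m s) (cycleStarSymm_mulVec_null s) hv h
  rwa [max_eq_right ha.le] at this

/-- The spectral gap of the unmodified graph is at least the minimum of the least nonzero
eigenvalue `α₂` of the cycle and the eigenvalue `β⁻` of the grounded star. -/
theorem min_le_spectralGap_unmodified (hn : 3 ≤ n) (hm : 4 ≤ m) :
    min (starBetaMinus m 1) (cycleAlpha n 2) ≤ spectralGap (cycleStarLaplacian n m 0) := by
  have key := not_spectralGap_cycleStar (n := n) hm 0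
    (· < min (starBetaMinus m 1) (cycleAlpha n 2)) (fun _ _ => lt_of_le_of_lt) ?_
  · rw [zero_pow two_ne_zero] at key
    exact not_lt.mp key
  intro a v ha hpos hv
  obtain ⟨hb, hα⟩ := lt_min_iff.mp ha
  have h1 := starBetaMinus_lt_one hm
  obtain ⟨θ, hθ0, hθπ, rfl⟩ := exists_angle hpos (by linarith)
  rw [lt_cycleAlpha_iff (by omega) (by omega) hθ0.le hθπ.le] at hα
  have hn' : (0 : ℝ) < n := by exact_mod_cast (by omega : 0 < n)
  exact eigenvector_eq_zero_of_uncoupled hn (Real.sin_pos_of_pos_of_lt_pi hθ0 hθπ).ne'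
    (Real.sin_pos_of_pos_of_lt_pi (by positivity) (by push_cast at hα; linarith)).ne'
    (by linarith) (pos_of_lt_starBetaMinus hm hb).ne' hv

theorem spectralGap_unmodified_le (hm : 4 ≤ m) :
    spectralGap (cycleStarLaplacian n m 0) ≤ starBetaMinus m 1 := by
  obtain ⟨v, hv, h⟩ := exists_eigenvector_uncoupled (n := n) hm (starBetaMinus_isRoot hm)
  have := spectralGap_cycleStar_le (starBetaMinus_pos hm) hv h
  rwa [zero_pow two_ne_zero] at this

/-- If `β⁻ < α₁`, the modified graph has no nonzero eigenvalue up to `β⁻`: its angle `θ` would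
satisfy `n θ < π`, so that all terms of the characteristic equation have the same sign. -/
theorem lt_spectralGap_modified (hn : 3 ≤ n) (hm : 4 ≤ m)
    (h : starBetaMinus m 1 < cycleAlpha n 1) {s : ℝ} (hs : s ≠ 0) :
    starBetaMinus m 1 < spectralGap (cycleStarLaplacian n m (s ^ 2)) := by
  refine not_le.mp (not_spectralGap_cycleStar (n := n) hm s
    (· ≤ starBetaMinus m 1) (fun _ _ => le_trans) ?_)
  intro a v hb hpos hv
  have h1 := starBetaMinus_lt_one hm
  obtain ⟨θ, hθ0, hθπ, rfl⟩ := exists_angle hpos (by linarith)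
  have hα := hb.trans_lt h
  rw [lt_cycleAlpha_iff (by omega) (by omega) hθ0.le hθπ.le] at hα
  have hn' : (0 : ℝ) < n := by exact_mod_cast (by omega : 0 < n)
  have hφ : 0 < n * θ / 2 := by positivity
  push_cast at hα
  refine eigenvector_eq_zero_of_cos_pos hn hm hs (Real.sin_pos_of_pos_of_lt_pi hθ0 hθπ)
    (Real.sin_pos_of_pos_of_lt_pi hφ (by linarith))
    (Real.cos_pos_of_mem_Ioo ⟨by linarith, by linarith⟩) hpos (by linarith) ?_ hv
  rcases hb.eq_or_lt with hb | hb
  · rw [hb, starBetaMinus_isRoot hm]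
  · exact (pos_of_lt_starBetaMinus hm hb).le

/-- If `α₁ < β⁻`, the characteristic equation changes sign between the angle of `α₁` and the angle
of `min β⁻ α₂`. -/
theorem spectralGap_modified_lt (hn : 3 ≤ n) (hm : 4 ≤ m)
    (h : cycleAlpha n 1 < starBetaMinus m 1) (hne : starBetaMinus m 1 ≠ cycleAlpha n 2)
    {s : ℝ} (hs : s ≠ 0) :
    spectralGap (cycleStarLaplacian n m (s ^ 2)) < min (starBetaMinus m 1) (cycleAlpha n 2) := by
  have hm' : (4 : ℝ) ≤ m := by exact_mod_cast hm
  have hn' : (3 : ℝ) ≤ n := by exact_mod_cast hn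
  have hb1 := starBetaMinus_lt_one hm
  have hπ := Real.pi_pos
  set c := min (starBetaMinus m 1) (cycleAlpha n 2) with hc
  have hcb : c ≤ starBetaMinus m 1 := min_le_left _ _
  have hcα : c ≤ cycleAlpha n 2 := min_le_right _ _
  have hαc : cycleAlpha n 1 < c := lt_min h (cycleAlpha_one_lt_two hn)
  have hθ₁ := angle_mem_Icc (n := n) (l := 1) (by omega) (by omega)
  set θ₁ := ((1 : ℕ) : ℝ) * Real.pi / n with hθ₁d
  have hα₁ : cycleAlpha n 1 = 2 - 2 * Real.cos θ₁ := cycleAlpha_eq n 1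
  have hα₁0 : 0 ≤ cycleAlpha n 1 := by rw [hα₁]; linarith [Real.cos_le_one θ₁]
  obtain ⟨θ₂, hθ₂0, hθ₂π, hθ₂⟩ := exists_angle (hα₁0.trans_lt hαc) (by linarith)
  have hθ : θ₁ < θ₂ := by
    rw [← hθ₂, hα₁] at hαc
    refine (Real.strictAntiOn_cos.lt_iff_gt ⟨hθ₂0.le, hθ₂π.le⟩ hθ₁).mp (by linarith)
  have hφ₁ : n * θ₁ / 2 = Real.pi / 2 := by rw [hθ₁d]; push_cast; field_simp
  have hθ₁0 : 0 < θ₁ := by rw [hθ₁d]; positivity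
  have hφ₂ : n * θ₂ / 2 ≤ Real.pi := by
    by_contra hlt
    have h2 := angle_mem_Icc (n := n) (l := 2) (by omega) (by omega)
    have h3 : ((2 : ℕ) : ℝ) * Real.pi / n < θ₂ := by
      rw [div_lt_iff₀ (by linarith)]; push_cast; linarith
    have h4 := Real.strictAntiOn_cos h2 ⟨hθ₂0.le, hθ₂π.le⟩ h3
    rw [← hθ₂, cycleAlpha_eq] at hcα
    linarith
  have hφ (θ : ℝ) (h1 : θ₁ < θ) (h2 : θ ≤ θ₂) : Real.cos (n * θ / 2) < 0 := by
    have h3 : n * θ₁ < n * θ := by gcongr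
    have h4 : n * θ ≤ n * θ₂ := by gcongr
    exact Real.cos_neg_of_pi_div_two_lt_of_lt (by linarith) (by linarith)
  set G : ℝ → ℝ := fun θ => 2 * Real.sin (n * θ / 2) * Real.sin θ *
        ((2 - 2 * Real.cos θ) ^ 2 - (m + 1) * (2 - 2 * Real.cos θ) + 1) +
      Real.cos (n * θ / 2) * s ^ 2 * ((2 - 2 * Real.cos θ) * (m - (2 - 2 * Real.cos θ))) with hG
  have hGc : Continuous G := by fun_prop
  have hG₁ : 0 < G θ₁ := by
    have h1 := Real.sin_pos_of_pos_of_lt_pi hθ₁0 (hθ.trans hθ₂π)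
    have h2 := pos_of_lt_starBetaMinus hm h
    rw [hα₁] at h2
    simp only [hG, hφ₁, Real.sin_pi_div_two, Real.cos_pi_div_two]
    rw [zero_mul, zero_mul, add_zero]
    positivity
  have hG₂ : G θ₂ < 0 := by
    -- The first term vanishes at `θ₂`, through the star factor or through the sine.
    have h1 : Real.sin (n * θ₂ / 2) * (c ^ 2 - (m + 1) * c + 1) = 0 := by
      rcases hne.lt_or_gt with h1 | h1
      · rw [hc, min_eq_left h1.le, starBetaMinus_isRoot hm, mul_zero]
      · have h2 : (2 : ℝ) * Real.pi / n = θ₂ := by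
          refine Real.injOn_cos
            (by exact_mod_cast angle_mem_Icc (n := n) (l := 2) (by omega) (by omega)) ⟨hθ₂0.le, hθ₂π.le⟩ ?_
          have := cycleAlpha_eq n 2
          rw [hc, min_eq_right h1.le] at hθ₂
          push_cast at this
          linarith
        rw [← h2, show (n : ℝ) * (2 * Real.pi / n) / 2 = Real.pi by field_simp, Real.sin_pi,
          zero_mul]
    have h2 := hφ θ₂ hθ le_rfl
    have h3 : 0 < c * (m - c) := mul_pos (by linarith) (by linarith)
    have h4 : 0 < s ^ 2 * (c * (m - c)) := by positivity
    simp only [hG, hθ₂]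
    have := mul_neg_of_neg_of_pos h2 h4
    linear_combination this + 2 * Real.sin θ₂ * h1
  obtain ⟨θ, ⟨hθl, hθr⟩, hGθ⟩ :=
    intermediate_value_Ioo' hθ.le hGc.continuousOn (Set.mem_Ioo.mpr ⟨hG₂, hG₁⟩)
  obtain ⟨v, hv, hvθ⟩ :=
    exists_eigenvector_of_characteristic_eq hn hm hs (hφ θ hθl hθr.le).ne hGθ
  have hcos₁ := Real.strictAntiOn_cos hθ₁ ⟨by linarith, by linarith⟩ hθl
  have hcos₂ := Real.strictAntiOn_cos (a := θ) ⟨by linarith, by linarith⟩ ⟨hθ₂0.le, hθ₂π.le⟩ hθr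
  refine (spectralGap_cycleStar_le (by linarith) hv hvθ).trans_lt ?_
  linarith

end

/-! ### Comparison of the spectral gaps -/

theorem theoremA (n m : ℕ) [NeZero n] [NeZero m] (hn : 3 ≤ n) (hm : 4 ≤ m)
    (hβ : ∀ l : ℕ, l ≤ n → starBetaMinus m 1 ≠ cycleAlpha n l)
    (δ₀ : ℝ) (hδ₀ : 0 < δ₀) :
    HasRealSpectrum (cycleStarLaplacian n m 0) ∧
    HasRealSpectrum (cycleStarLaplacian n m δ₀) ∧
    (cycleAlpha n 1 < starBetaMinus m 1 →
      spectralGap (cycleStarLaplacian n m δ₀) < spectralGap (cycleStarLaplacian n m 0)) ∧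
    (starBetaMinus m 1 < cycleAlpha n 1 →
      spectralGap (cycleStarLaplacian n m 0) < spectralGap (cycleStarLaplacian n m δ₀)) := by
  obtain ⟨s, hs, rfl⟩ : ∃ s : ℝ, s ≠ 0 ∧ δ₀ = s ^ 2 :=
    ⟨√δ₀, (Real.sqrt_pos.mpr hδ₀).ne', (Real.sq_sqrt hδ₀.le).symm⟩
  have hreal (t : ℝ) : HasRealSpectrum (cycleStarLaplacian n m (t ^ 2)) :=
    hasRealSpectrum_of_charpoly_eq (isHermitian_cycleStarSymm t) charpoly_cycleStarLaplacian
  refine ⟨by simpa using hreal 0, hreal s, fun h => ?_, fun h => ?_⟩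
  · exact (spectralGap_modified_lt hn hm h (hβ 2 (by omega)) hs).trans_le
      (min_le_spectralGap_unmodified hn hm)
  · exact (spectralGap_unmodified_le hm).trans_lt (lt_spectralGap_modified hn hm h hs)
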